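/- All rings are commutative and unital. A derivation $D : R \to R$ of a ring $R$ is an additive map satisfying the Leibniz rule; it is \emph{locally nilpotent} if for each $r \in R$ there exists $m > 0$ with $D^m(r) = 0$. The ring $R$ is \emph{rigid} if its only locally nilpotent derivation is $0$, and \emph{non-rigid} otherwise. If $B = \bigoplus_{i \in \mathbb{Z}} B_i$ is a $\mathbb{Z}$-graded ring and $d \ge 1$ is an integer, let $B^{(d)} = \bigoplus_{i \in d\mathbb{Z}} B_i$, a subring of $B$. Let $\mathbf{k}$ be a field of characteristic zero and let $B = \bigoplus_{i \in \mathbb{Z}} B_i$ be a $\mathbb{Z}$-graded integral domain that is integrally closed in its field of fractions and is a finitely generated $\mathbf{k}$-algebra. Suppose that $B = B_0[x_1, \dots, x_n]$ where $n \ge 2$ and, for each $i \in \{1, \dots, n\}$, $x_i$ is a prime element of $B$ that is homogeneous of degree $d_i \in \mathbb{Z} \setminus \{0\}$. Assume that (i) for every $i \in \{1, \dots, n\}$, the greatest common divisor of the $n-1$ integers $d_j$ with $j \neq i$ is $1$; (ii) for every choice of distinct $i, j \in \{1, \dots, n\}$, $x_i$ and $x_j$ are not associates in $B$. Then the following are equivalent: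 (a) $B$ is non-rigid; (b) $B^{(d)}$ is non-rigid for all $d \ge 1$; (c) $B^{(d)}$ is non-rigid for some $d \ge 1$. -/

import Mathlib

/-- A derivation `D : R → R` is locally nilpotent if every element of `R` is killed by some
iterate of `D`. -/
def IsLocallyNilpotentDerivation {R : Type*} [CommRing R] (D : Derivation ℤ R R) : Prop :=
  ∀ r : R, ∃ m : ℕ, D^[m] r = 0

/-- A ring is rigid if its only locally nilpotent derivation is zero. Derivations of a ring are
additive maps satisfying the Leibniz rule, that is, `ℤ`-linear derivations. -/
def IsRigidRing (R : Type*) [CommRing R] : Prop :=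
  ∀ D : Derivation ℤ R R, IsLocallyNilpotentDerivation D → D = 0

/-- The subring `B^(d) = ⨁_{i ∈ dℤ} B_i` of a `ℤ`-graded ring `B`: the elements all of whose
nonzero homogeneous components have degree divisible by `d`. -/
def veroneseSubring {B : Type*} [CommRing B] (𝒜 : ℤ → AddSubgroup B) [GradedRing 𝒜] (d : ℕ) :
    Subring B where
  carrier := {b | ∀ i : ℤ, ¬ (d : ℤ) ∣ i → GradedRing.proj 𝒜 i b = 0}
  zero_mem' := fun i _ => map_zero _
  one_mem' := fun i hi => by
    have h : i ≠ 0 := fun h => hi (h ▸ dvd_zero _)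
    rw [GradedRing.proj_apply,
      DirectSum.decompose_of_mem_ne 𝒜 SetLike.GradedOne.one_mem (Ne.symm h)]
  add_mem' := fun {a b} ha hb i hi => by rw [map_add, ha i hi, hb i hi, add_zero]
  neg_mem' := fun {a} ha i hi => by rw [map_neg, ha i hi, neg_zero]
  mul_mem' := fun {a b} ha hb i hi => by
    classical
    rw [← DirectSum.sum_support_decompose 𝒜 a, ← DirectSum.sum_support_decompose 𝒜 b,
      Finset.sum_mul_sum, map_sum]
    refine Finset.sum_eq_zero fun j _ => ?_
    rw [map_sum]
    refine Finset.sum_eq_zero fun l _ => ?_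
    by_cases hj : (d : ℤ) ∣ j
    · by_cases hl : (d : ℤ) ∣ l
      · have hne : j + l ≠ i := fun h => hi (h ▸ dvd_add hj hl)
        rw [GradedRing.proj_apply, DirectSum.decompose_of_mem_ne 𝒜
          (SetLike.GradedMul.mul_mem (SetLike.coe_mem _) (SetLike.coe_mem _)) hne]
      · have h0 := hb l hl
        rw [GradedRing.proj_apply] at h0
        rw [h0, mul_zero, map_zero]
    · have h0 := ha j hj
      rw [GradedRing.proj_apply] at h0
      rw [h0, zero_mul, map_zero]

/-! From `B` to its Veronese subrings: finite generation gives a locally nilpotent derivation a top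
homogeneous component, so `D` may be taken homogeneous, of degree `e`. Modulo `d`, the degrees of
nonzero homogeneous kernel elements form a subgroup of `ℤ`. If it is all of `ℤ`, some kernel element
`f` has degree congruent to `-e`; then `f • D` has degree divisible by `d` and restricts to a
nonzero derivation of `B^(d)`. If it is `e'ℤ ≠ ℤ`, the gcd condition gives two distinct `x i`, `x j`
whose degrees `e'` does not divide. Reducing them modulo a homogeneous local slice `s` leaves
remainders in the kernel of forbidden degree, hence zero. So both primes divide `s` and neither is
in the kernel; their product divides `s`, which has `D`-degree only 1 (`dvd_of_kernel_degrees`).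

From `B^(d)` to `B`: a derivation of `B^(d)` extends to the fraction field `Frac B`, algebraic over
`B^(d)`. For homogeneous `b` and each `i`, a monomial `u` in the `x j`, `j ≠ i`, brings `u * b` into
`B^(d)`, so `u ^ d` is a denominator of `E b` prime to `x i`. As `i` varies the denominators cancel
and `E b ∈ B` (`exists_extend_veronese`). Local nilpotency follows by induction on the degree of `b
^ d` (`isLocallyNilpotent_of_veronese`). -/

open Finset in
/-- The iterated Leibniz rule. -/
theorem Derivation.iterate_leibniz {R : Type*} [CommRing R] (D : Derivation ℤ R R) (n : ℕ)
    (a b : R) :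
    D^[n] (a * b) = ∑ ij ∈ antidiagonal n, (n.choose ij.1 : R) * (D^[ij.1] a * D^[ij.2] b) := by
  induction n with
  | zero => simp
  | succ n ih =>
    rw [Finset.sum_antidiagonal_choose_succ_mul
      (fun i j => D^[i] a * D^[j] b) n, Function.iterate_succ_apply', ih, map_sum,
      ← Finset.sum_add_distrib]
    refine Finset.sum_congr rfl fun ij hij => ?_
    have hsymm : n.choose ij.2 = n.choose ij.1 :=
      Nat.choose_symm_of_eq_add (by rw [HasAntidiagonal.mem_antidiagonal] at hij; omega)
    simp only [Derivation.leibniz, Function.iterate_succ_apply', smul_eq_mul,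
      Derivation.map_natCast, hsymm]
    ring

/-! ### The degree function of a locally nilpotent derivation -/

namespace LocallyNilpotent

section Degree

variable {R : Type*} [CommRing R]

/-- `b` has degree `m` with respect to `D`. -/
def HasDegree (D : Derivation ℤ R R) (b : R) (m : ℕ) : Prop :=
  D^[m] b ≠ 0 ∧ D^[m + 1] b = 0

theorem iterate_eq_zero_of_le {D : Derivation ℤ R R} {b : R} {m n : ℕ} (h : D^[m] b = 0)
    (hmn : m ≤ n) : D^[n] b = 0 := by
  obtain ⟨l, rfl⟩ := Nat.exists_eq_add_of_le hmn
  rw [add_comm, Function.iterate_add_apply, h, iterate_map_zero]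

theorem HasDegree.unique {D : Derivation ℤ R R} {b : R} {m n : ℕ} (hm : HasDegree D b m)
    (hn : HasDegree D b n) : m = n := by
  by_contra hne
  rcases Nat.lt_or_gt_of_ne hne with h | h
  · exact hn.1 (iterate_eq_zero_of_le hm.2 h)
  · exact hm.1 (iterate_eq_zero_of_le hn.2 h)

theorem HasDegree.ne_zero {D : Derivation ℤ R R} {b : R} {m : ℕ} (hm : HasDegree D b m) :
    b ≠ 0 := by
  rintro rfl
  exact hm.1 (iterate_map_zero D m)

theorem hasDegree_zero_iff {D : Derivation ℤ R R} {b : R} :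
    HasDegree D b 0 ↔ b ≠ 0 ∧ D b = 0 := Iff.rfl

theorem exists_hasDegree {D : Derivation ℤ R R} {b : R} (hD : ∃ m : ℕ, D^[m] b = 0)
    (hb : b ≠ 0) : ∃ m, HasDegree D b m := by
  classical
  have hpos : Nat.find hD ≠ 0 := fun h => hb (by simpa [h] using Nat.find_spec hD)
  obtain ⟨m, hm⟩ := Nat.exists_eq_succ_of_ne_zero hpos
  exact ⟨m, Nat.find_min hD (hm ▸ Nat.lt_succ_self m), by
    simpa only [hm] using Nat.find_spec hD⟩

theorem HasDegree.derivation {D : Derivation ℤ R R} {b : R} {m : ℕ}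
    (h : HasDegree D b (m + 1)) : HasDegree D (D b) m := h

/-- In the iterated Leibniz rule of order `m + n` only the term `(m, n)` survives, and its binomial
coefficient is nonzero in characteristic zero. -/
theorem HasDegree.mul [IsDomain R] [CharZero R] {D : Derivation ℤ R R} {a b : R} {m n : ℕ}
    (ha : HasDegree D a m) (hb : HasDegree D b n) : HasDegree D (a * b) (m + n) := by
  constructor
  · rw [D.iterate_leibniz, Finset.sum_eq_single (m, n)]
    · refine mul_ne_zero ?_ (mul_ne_zero ha.1 hb.1)
      exact_mod_cast (Nat.choose_pos (Nat.le_add_right m n)).ne'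
    · rintro ⟨i, j⟩ hij hne
      rw [Finset.HasAntidiagonal.mem_antidiagonal] at hij
      rcases lt_trichotomy i m with h | rfl | h
      · rw [iterate_eq_zero_of_le hb.2 (show n + 1 ≤ j by simp at hij; omega)]; simp
      · simp at hij hne; omega
      · rw [iterate_eq_zero_of_le ha.2 (show m + 1 ≤ i by omega)]; simp
    · simp
  · rw [D.iterate_leibniz]
    refine Finset.sum_eq_zero ?_
    rintro ⟨i, j⟩ hij
    rw [Finset.HasAntidiagonal.mem_antidiagonal] at hij
    rcases le_or_gt i m with h | h
    · rw [iterate_eq_zero_of_le hb.2 (show n + 1 ≤ j by simp at hij; omega)]; simp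
    · rw [iterate_eq_zero_of_le ha.2 (show m + 1 ≤ i by omega)]; simp

theorem hasDegree_one [IsDomain R] (D : Derivation ℤ R R) : HasDegree D 1 0 :=
  hasDegree_zero_iff.2 ⟨one_ne_zero, D.map_one_eq_zero⟩

theorem hasDegree_natCast [IsDomain R] [CharZero R] (D : Derivation ℤ R R) {n : ℕ} (hn : n ≠ 0) :
    HasDegree D (n : R) 0 :=
  hasDegree_zero_iff.2 ⟨by exact_mod_cast hn, D.map_natCast n⟩

theorem HasDegree.pow [IsDomain R] [CharZero R] {D : Derivation ℤ R R} {a : R} {m : ℕ}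
    (ha : HasDegree D a m) (n : ℕ) : HasDegree D (a ^ n) (n * m) := by
  induction n with
  | zero => simpa using hasDegree_one D
  | succ n ih =>
    rw [pow_succ, Nat.succ_mul]
    exact ih.mul ha

/-- Locally nilpotent derivations kill units. -/
theorem derivation_eq_zero_of_isUnit [IsDomain R] [CharZero R] {D : Derivation ℤ R R}
    (hD : IsLocallyNilpotentDerivation D) {u : R} (hu : IsUnit u) : D u = 0 := by
  obtain ⟨v, huv⟩ := hu.exists_right_inv
  have hv : v ≠ 0 := by
    rintro rfl
    simp at huv
  obtain ⟨m, hm⟩ := exists_hasDegree (hD u) hu.ne_zero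
  obtain ⟨n, hn⟩ := exists_hasDegree (hD v) hv
  have h := (hm.mul hn).unique (huv ▸ hasDegree_one D)
  obtain rfl : m = 0 := by omega
  exact hm.2

theorem iterate_mul_of_derivation_eq_zero {D : Derivation ℤ R R} {f : R} (hf : D f = 0) (n : ℕ)
    (b : R) : (f • D)^[n] b = f ^ n * D^[n] b := by
  induction n with
  | zero => simp
  | succ n ih =>
    have hfn : D (f ^ n) = 0 := by rw [Derivation.leibniz_pow, hf]; simp
    rw [Function.iterate_succ_apply', ih, Function.iterate_succ_apply', Derivation.smul_apply,
      Derivation.leibniz, hfn, smul_eq_mul, smul_eq_mul, smul_eq_mul]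
    ring

theorem iterate_localSlice_mul {D : Derivation ℤ R R} {s : R} (hs : D (D s) = 0) (n : ℕ)
    (b : R) : D^[n + 1] (s * b) = s * D^[n + 1] b + (n + 1) * D s * D^[n] b := by
  induction n with
  | zero => simp [mul_comm]
  | succ n ih =>
    rw [Function.iterate_succ_apply', ih]
    simp only [map_add, Derivation.leibniz, hs, Function.iterate_succ_apply', smul_eq_mul,
      Derivation.map_natCast, Derivation.map_one_eq_zero, Nat.cast_add, Nat.cast_one]
    ring

end Degree

end LocallyNilpotent

/-! ### Extending derivations along algebraic extensions -/

/-- A derivation of a domain of characteristic zero extends to every algebraic field extension. -/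
theorem Derivation.exists_extend_of_isAlgebraic {S R L : Type*} [CommRing S] [CommRing R]
    [IsDomain R] [CharZero R] [Field L] [Algebra S R] [Algebra S L] [Algebra R L]
    [IsScalarTower S R L] [FaithfulSMul R L] [Algebra.IsAlgebraic R L] (D : Derivation S R R) :
    ∃ E : L →+ L, (∀ a b, E (a * b) = a * E b + b * E a) ∧
      ∀ r, E (algebraMap R L r) = algebraMap R L (D r) := by
  let : Algebra (FractionRing R) L := FractionRing.liftAlgebra R L
  have : Algebra.IsAlgebraic (FractionRing R) L :=
    (IsFractionRing.comap_isAlgebraic_iff (A := R) (K := FractionRing R)).1 inferInstance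
  -- Localizations and separable algebraic extensions are formally étale, so `R → L` is too. Hence
  -- `Ω[L⁄S]` is the base change of `Ω[R⁄S]`, and the linear map classifying `D` extends.
  have : Algebra.FormallyEtale R (FractionRing R) :=
    Algebra.FormallyEtale.of_isLocalization (nonZeroDivisors R)
  have : CharZero (FractionRing R) :=
    charZero_of_injective_algebraMap (IsFractionRing.injective R (FractionRing R))
  have : Algebra.FormallyEtale (FractionRing R) L := Algebra.FormallyEtale.of_isSeparable _ _
  have : Algebra.FormallyEtale R L := Algebra.FormallyEtale.comp R (FractionRing R) L
  let φ : Ω[R⁄S] →ₗ[R] L := (Algebra.linearMap R L) ∘ₗ D.liftKaehlerDifferential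
  let ψ : Ω[L⁄S] →ₗ[L] L :=
    (φ.liftBaseChange L) ∘ₗ
      (KaehlerDifferential.tensorKaehlerEquivOfFormallyEtale S R L).symm.toLinearMap
  refine ⟨(ψ.compDer (KaehlerDifferential.D S L)).toLinearMap.toAddMonoidHom,
    (ψ.compDer (KaehlerDifferential.D S L)).leibniz, fun r => ?_⟩
  have h := KaehlerDifferential.tensorKaehlerEquivOfFormallyEtale_symm_D_algebraMap S R L r
  simp [ψ, φ, h]

theorem Derivation.exists_extend_fractionRing {R B : Type*} [CommRing R] [IsDomain R] [CharZero R]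
    [CommRing B] [IsDomain B] [Algebra R B] [FaithfulSMul R B] [Algebra.IsAlgebraic R B]
    (D : Derivation ℤ R R) :
    ∃ E : FractionRing B →+ FractionRing B, (∀ a b, E (a * b) = a * E b + b * E a) ∧
      ∀ r, E (algebraMap R _ r) = algebraMap R _ (D r) := by
  have : Algebra.IsAlgebraic B (FractionRing B) :=
    IsLocalization.isAlgebraic _ (nonZeroDivisors B)
  have : Algebra.IsAlgebraic R (FractionRing B) := Algebra.IsAlgebraic.trans R B (FractionRing B)
  exact D.exists_extend_of_isAlgebraic (L := FractionRing B)

/-! ### Homogeneous components in a `ℤ`-graded ring -/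

section Graded

variable {B : Type*} [CommRing B] (𝒜 : ℤ → AddSubgroup B) [GradedRing 𝒜]

open DirectSum

theorem GradedRing.proj_mem (i : ℤ) (b : B) : GradedRing.proj 𝒜 i b ∈ 𝒜 i :=
  SetLike.coe_mem _

theorem GradedRing.proj_of_mem {i : ℤ} {b : B} (hb : b ∈ 𝒜 i) : GradedRing.proj 𝒜 i b = b :=
  decompose_of_mem_same 𝒜 hb

theorem GradedRing.proj_of_mem_ne {i j : ℤ} {b : B} (hb : b ∈ 𝒜 i) (h : i ≠ j) :
    GradedRing.proj 𝒜 j b = 0 :=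
  decompose_of_mem_ne 𝒜 hb h

open Classical in
/-- The degrees of the nonzero homogeneous components of an element. -/
noncomputable def gradedSupport (b : B) : Finset ℤ := (decompose 𝒜 b).support

theorem mem_gradedSupport {b : B} {i : ℤ} :
    i ∈ gradedSupport 𝒜 b ↔ GradedRing.proj 𝒜 i b ≠ 0 := by
  classical
  exact GradedRing.mem_support_iff 𝒜 b i

theorem sum_gradedSupport (b : B) : ∑ i ∈ gradedSupport 𝒜 b, GradedRing.proj 𝒜 i b = b := by
  classical
  exact sum_support_decompose 𝒜 b

theorem gradedSupport_nonempty {b : B} (hb : b ≠ 0) : (gradedSupport 𝒜 b).Nonempty := by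
  rw [Finset.nonempty_iff_ne_empty]
  intro h
  apply hb
  rw [← sum_gradedSupport 𝒜 b, h, Finset.sum_empty]

theorem mem_of_proj_eq_zero {b : B} {p : ℤ} (h : ∀ i, i ≠ p → GradedRing.proj 𝒜 i b = 0) :
    b ∈ 𝒜 p := by
  rw [← sum_gradedSupport 𝒜 b]
  refine sum_mem fun i hi => ?_
  by_cases hip : i = p
  · exact hip ▸ GradedRing.proj_mem 𝒜 i b
  · exact absurd (h i hip) ((mem_gradedSupport 𝒜).1 hi)

theorem homogeneous_induction {motive : B → Prop} (b : B) (zero : motive 0)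
    (hom : ∀ i, ∀ c ∈ 𝒜 i, motive c) (add : ∀ a b, motive a → motive b → motive (a + b)) :
    motive b :=
  Decomposition.inductionOn 𝒜 zero (fun m => hom _ m m.2) add b

theorem proj_mul_left {i : ℤ} {a : B} (ha : a ∈ 𝒜 i) (j : ℤ) (b : B) :
    GradedRing.proj 𝒜 (i + j) (a * b) = a * GradedRing.proj 𝒜 j b :=
  coe_decompose_mul_add_of_left_mem 𝒜 ha

theorem proj_mul_of_unique {a b : B} {p q : ℤ}
    (h : ∀ i j, GradedRing.proj 𝒜 i a ≠ 0 → GradedRing.proj 𝒜 j b ≠ 0 → i + j = p + q → i = p) :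
    GradedRing.proj 𝒜 (p + q) (a * b) = GradedRing.proj 𝒜 p a * GradedRing.proj 𝒜 q b := by
  have key : ∀ i, GradedRing.proj 𝒜 (p + q) (GradedRing.proj 𝒜 i a * b) =
      GradedRing.proj 𝒜 i a * GradedRing.proj 𝒜 (p + q - i) b := fun i => by
    rw [← proj_mul_left 𝒜 (GradedRing.proj_mem 𝒜 i a), add_sub_cancel]
  conv_lhs => rw [← sum_gradedSupport 𝒜 a, Finset.sum_mul, map_sum]
  rw [Finset.sum_eq_single p]
  · rw [key, add_sub_cancel_left]
  · intro i hi hip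
    rw [key]
    by_contra hne
    exact hip (h i (p + q - i) (left_ne_zero_of_mul hne) (right_ne_zero_of_mul hne) (by ring))
  · intro hp
    rw [key, not_not.1 (mt (mem_gradedSupport 𝒜).2 hp), zero_mul]

theorem proj_one_of_ne {i : ℤ} (hi : i ≠ 0) : GradedRing.proj 𝒜 i (1 : B) = 0 :=
  GradedRing.proj_of_mem_ne 𝒜 SetLike.GradedOne.one_mem hi.symm

/-- The top components of `u` and of its inverse `v` have nonzero product, a component of `1`, so
the top degrees sum to 0; so do the bottom degrees. Hence top and bottom of `u` agree. -/
theorem exists_mem_of_isUnit [IsDomain B] {u : B} (hu : IsUnit u) : ∃ p, u ∈ 𝒜 p := by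
  obtain ⟨v, huv⟩ := hu.exists_right_inv
  have hv : v ≠ 0 := by
    rintro rfl
    simp at huv
  have hnu := gradedSupport_nonempty 𝒜 hu.ne_zero
  have hnv := gradedSupport_nonempty 𝒜 hv
  have hmax : (gradedSupport 𝒜 u).max' hnu + (gradedSupport 𝒜 v).max' hnv = 0 := by
    by_contra hne
    have h := proj_mul_of_unique 𝒜 (a := u) (b := v) (p := (gradedSupport 𝒜 u).max' hnu)
      (q := (gradedSupport 𝒜 v).max' hnv) fun i j hi hj hij => by
        have h1 := Finset.le_max' _ i ((mem_gradedSupport 𝒜).2 hi)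
        have h2 := Finset.le_max' _ j ((mem_gradedSupport 𝒜).2 hj)
        omega
    rw [huv, proj_one_of_ne 𝒜 hne] at h
    exact mul_ne_zero ((mem_gradedSupport 𝒜).1 (Finset.max'_mem _ hnu))
      ((mem_gradedSupport 𝒜).1 (Finset.max'_mem _ hnv)) h.symm
  have hmin : (gradedSupport 𝒜 u).min' hnu + (gradedSupport 𝒜 v).min' hnv = 0 := by
    by_contra hne
    have h := proj_mul_of_unique 𝒜 (a := u) (b := v) (p := (gradedSupport 𝒜 u).min' hnu)
      (q := (gradedSupport 𝒜 v).min' hnv) fun i j hi hj hij => by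
        have h1 := Finset.min'_le _ i ((mem_gradedSupport 𝒜).2 hi)
        have h2 := Finset.min'_le _ j ((mem_gradedSupport 𝒜).2 hj)
        omega
    rw [huv, proj_one_of_ne 𝒜 hne] at h
    exact mul_ne_zero ((mem_gradedSupport 𝒜).1 (Finset.min'_mem _ hnu))
      ((mem_gradedSupport 𝒜).1 (Finset.min'_mem _ hnv)) h.symm
  refine ⟨(gradedSupport 𝒜 u).min' hnu, mem_of_proj_eq_zero 𝒜 fun i hi => ?_⟩
  by_contra hne
  have h1 := Finset.min'_le _ i ((mem_gradedSupport 𝒜).2 hne)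
  have h2 := Finset.le_max' _ i ((mem_gradedSupport 𝒜).2 hne)
  have h3 := Finset.min'_le _ _ (Finset.max'_mem _ hnv)
  omega

/-- A field contained in a `ℤ`-graded domain lies in degree zero. -/
theorem algebraMap_mem_zero {k : Type*} [Field k] [Algebra k B] [IsDomain B] (c : k) :
    algebraMap k B c ∈ 𝒜 0 := by
  by_cases hc : c = 0
  · simp [hc, zero_mem]
  obtain ⟨p, hp⟩ := exists_mem_of_isUnit 𝒜 ((IsUnit.mk0 c hc).map (algebraMap k B))
  -- The unit `1 + c` is homogeneous as well, which is impossible if `c` has nonzero degree.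
  by_cases hc1 : 1 + c = 0
  · rw [eq_neg_of_add_eq_zero_right hc1, map_neg, map_one]
    exact neg_mem SetLike.GradedOne.one_mem
  obtain ⟨q, hq⟩ := exists_mem_of_isUnit 𝒜 ((IsUnit.mk0 _ hc1).map (algebraMap k B))
  by_contra h0
  have hp0 : p ≠ 0 := fun h => h0 (h ▸ hp)
  rw [map_add, map_one] at hq
  have hproj : ∀ i, i ≠ q → GradedRing.proj 𝒜 i (1 : B) +
      GradedRing.proj 𝒜 i (algebraMap k B c) = 0 := fun i hi => by
    rw [← map_add, GradedRing.proj_of_mem_ne 𝒜 hq hi.symm]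
  by_cases hq0 : q = 0
  · have := hproj p (hq0 ▸ hp0)
    rw [proj_one_of_ne 𝒜 hp0, zero_add, GradedRing.proj_of_mem 𝒜 hp] at this
    exact ((IsUnit.mk0 c hc).map (algebraMap k B)).ne_zero this
  · have := hproj 0 (Ne.symm hq0)
    rw [GradedRing.proj_of_mem 𝒜 SetLike.GradedOne.one_mem,
      GradedRing.proj_of_mem_ne 𝒜 hp hp0, add_zero] at this
    exact one_ne_zero this

end Graded

/-! ### Homogeneous components of a derivation -/

section HomogeneousComponent

variable {B : Type*} [CommRing B] (𝒜 : ℤ → AddSubgroup B) [GradedRing 𝒜]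

open DirectSum

/-- The additive map sending a homogeneous element `b` of degree `i` to the component of degree
`i + j` of `D b`. -/
noncomputable def derivationComponentAux (D : Derivation ℤ B B) (j : ℤ) : B →+ B :=
  (DirectSum.toAddMonoid fun i => (GradedRing.proj 𝒜 (i + j)).comp
    (D.toLinearMap.toAddMonoidHom.comp (𝒜 i).subtype)).comp
      (decomposeAddEquiv 𝒜).toAddMonoidHom

theorem derivationComponentAux_of_mem (D : Derivation ℤ B B) (j : ℤ) {i : ℤ} {b : B}
    (hb : b ∈ 𝒜 i) : derivationComponentAux 𝒜 D j b = GradedRing.proj 𝒜 (i + j) (D b) := by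
  have h : decomposeAddEquiv 𝒜 b = DirectSum.of (fun i => 𝒜 i) i ⟨b, hb⟩ :=
    decompose_of_mem 𝒜 hb
  simp [derivationComponentAux, h]

theorem derivationComponentAux_leibniz (D : Derivation ℤ B B) (j : ℤ) (a b : B) :
    derivationComponentAux 𝒜 D j (a * b) =
      a • derivationComponentAux 𝒜 D j b + b • derivationComponentAux 𝒜 D j a := by
  induction a using homogeneous_induction 𝒜 with
  | zero => simp
  | add a a' h h' => simp only [add_mul, map_add, h, h', add_smul, smul_add]; abel
  | hom p a ha =>
    induction b using homogeneous_induction 𝒜 with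
    | zero => simp
    | add b b' h h' => simp only [mul_add, map_add, h, h', add_smul, smul_add]; abel
    | hom q b hb =>
      rw [derivationComponentAux_of_mem 𝒜 D j ha, derivationComponentAux_of_mem 𝒜 D j hb,
        derivationComponentAux_of_mem 𝒜 D j (SetLike.GradedMul.mul_mem ha hb), D.leibniz, map_add,
        smul_eq_mul, smul_eq_mul, smul_eq_mul, smul_eq_mul, ← proj_mul_left 𝒜 ha,
        ← proj_mul_left 𝒜 hb]
      congr 2 <;> congr 1 <;> ring

/-- The homogeneous component of degree `j` of a derivation of a graded ring. -/
noncomputable def derivationComponent (D : Derivation ℤ B B) (j : ℤ) : Derivation ℤ B B :=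
  Derivation.mk' (derivationComponentAux 𝒜 D j).toIntLinearMap
    (derivationComponentAux_leibniz 𝒜 D j)

theorem derivationComponent_of_mem (D : Derivation ℤ B B) (j : ℤ) {i : ℤ} {b : B}
    (hb : b ∈ 𝒜 i) : derivationComponent 𝒜 D j b = GradedRing.proj 𝒜 (i + j) (D b) :=
  derivationComponentAux_of_mem 𝒜 D j hb

theorem derivationComponent_mem (D : Derivation ℤ B B) (j : ℤ) {i : ℤ} {b : B}
    (hb : b ∈ 𝒜 i) : derivationComponent 𝒜 D j b ∈ 𝒜 (i + j) := by
  rw [derivationComponent_of_mem 𝒜 D j hb]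
  exact GradedRing.proj_mem 𝒜 _ _

theorem exists_derivationComponent_ne_zero {D : Derivation ℤ B B} (hD : D ≠ 0) :
    ∃ j, derivationComponent 𝒜 D j ≠ 0 := by
  by_contra! h
  refine hD (Derivation.ext fun b => ?_)
  induction b using homogeneous_induction 𝒜 with
  | zero => simp
  | add a b ha hb => rw [map_add, ha, hb, map_add]
  | hom i b hb =>
    rw [← sum_gradedSupport 𝒜 (D b)]
    refine Finset.sum_eq_zero fun l _ => ?_
    have := derivationComponent_of_mem 𝒜 D (l - i) hb
    rw [h, add_sub_cancel] at this
    exact this.symm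

theorem proj_derivation (D : Derivation ℤ B B) (l : ℤ) (b : B) :
    GradedRing.proj 𝒜 l (D b) =
      ∑ i ∈ gradedSupport 𝒜 b, derivationComponent 𝒜 D (l - i) (GradedRing.proj 𝒜 i b) := by
  conv_lhs => rw [← sum_gradedSupport 𝒜 b, map_sum, map_sum]
  refine Finset.sum_congr rfl fun i _ => ?_
  rw [derivationComponent_of_mem 𝒜 D _ (GradedRing.proj_mem 𝒜 i b), add_sub_cancel]

/-- Only the top component contributes to the highest possible degree of `D^[m] b`, so nilpotency of
`D` on `b` passes to that component. -/
theorem iterate_derivationComponent {D : Derivation ℤ B B} {e : ℤ}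
    (he : ∀ j, e < j → derivationComponent 𝒜 D j = 0) {i : ℤ} {b : B} (hb : b ∈ 𝒜 i) (m : ℕ) :
    (∀ l, i + m * e < l → GradedRing.proj 𝒜 l (D^[m] b) = 0) ∧
      (derivationComponent 𝒜 D e)^[m] b = GradedRing.proj 𝒜 (i + m * e) (D^[m] b) := by
  induction m with
  | zero =>
    refine ⟨fun l hl => GradedRing.proj_of_mem_ne 𝒜 hb (by simp at hl; omega), ?_⟩
    simp [GradedRing.proj_of_mem 𝒜 hb]
  | succ m ih =>
    have hcast : i + ((m + 1 : ℕ) : ℤ) * e = i + m * e + e := by push_cast; ring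
    rw [hcast]
    have hle : ∀ l ∈ gradedSupport 𝒜 (D^[m] b), l ≤ i + m * e := fun l hl =>
      not_lt.1 fun h => (mem_gradedSupport 𝒜).1 hl (ih.1 l h)
    constructor
    · intro l hl
      rw [Function.iterate_succ_apply', proj_derivation]
      refine Finset.sum_eq_zero fun j hj => ?_
      rw [he _ (by have := hle j hj; omega), Derivation.zero_apply]
    · rw [Function.iterate_succ_apply', Function.iterate_succ_apply', proj_derivation,
        Finset.sum_eq_single (i + m * e), ih.2, add_sub_cancel_left]
      · intro j hj hne
        rw [he _ (by have := hle j hj; omega), Derivation.zero_apply]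
      · intro h
        rw [not_not.1 (mt (mem_gradedSupport 𝒜).2 h), map_zero]

theorem isLocallyNilpotent_of_homogeneous {D : Derivation ℤ B B}
    (h : ∀ i, ∀ b ∈ 𝒜 i, ∃ m : ℕ, D^[m] b = 0) : IsLocallyNilpotentDerivation D := by
  intro b
  induction b using homogeneous_induction 𝒜 with
  | zero => exact ⟨0, rfl⟩
  | hom i b hb => exact h i b hb
  | add a b ha hb =>
    obtain ⟨m, hm⟩ := ha
    obtain ⟨n, hn⟩ := hb
    refine ⟨max m n, ?_⟩
    rw [iterate_map_add, LocallyNilpotent.iterate_eq_zero_of_le hm (le_max_left _ _),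
      LocallyNilpotent.iterate_eq_zero_of_le hn (le_max_right _ _), add_zero]

variable {k : Type*} [Field k] [Algebra k B]

/-- The derivation components of large degree vanish on a finitely generated algebra. -/
theorem exists_derivationComponent_eq_zero_of_lt [IsDomain B] [CharZero B]
    [Algebra.FiniteType k B] {D : Derivation ℤ B B} (hD : IsLocallyNilpotentDerivation D) :
    ∃ N, ∀ j, N < j → derivationComponent 𝒜 D j = 0 := by
  classical
  obtain ⟨S, hS⟩ := (Algebra.FiniteType.out : (⊤ : Subalgebra k B).FG)
  have hbound : ∀ b : B, ∃ N, ∀ j, N < j → derivationComponent 𝒜 D j b = 0 := by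
    intro b
    induction b using homogeneous_induction 𝒜 with
    | zero => exact ⟨0, fun j _ => map_zero _⟩
    | add a b ha hb =>
      obtain ⟨M, hM⟩ := ha
      obtain ⟨N, hN⟩ := hb
      refine ⟨max M N, fun j hj => ?_⟩
      rw [map_add, hM j (lt_of_le_of_lt (le_max_left _ _) hj),
        hN j (lt_of_le_of_lt (le_max_right _ _) hj), add_zero]
    | hom i b hb =>
      obtain ⟨N, hN⟩ := (gradedSupport 𝒜 (D b)).bddAbove
      refine ⟨N - i, fun j hj => ?_⟩
      rw [derivationComponent_of_mem 𝒜 D j hb]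
      by_contra hne
      have := hN ((mem_gradedSupport 𝒜).2 hne)
      omega
  choose N hN using hbound
  obtain ⟨M, hM⟩ := (S.image N).bddAbove
  refine ⟨M, fun j hj => Derivation.ext fun b => ?_⟩
  have hb : b ∈ Algebra.adjoin k (S : Set B) := hS ▸ Algebra.mem_top
  induction hb using Algebra.adjoin_induction with
  | mem s hs =>
    exact hN s j (lt_of_le_of_lt (hM (by simpa using ⟨s, hs, rfl⟩)) hj)
  | algebraMap c =>
    rw [derivationComponent_of_mem 𝒜 D j (algebraMap_mem_zero 𝒜 c)]
    -- Scalars are zero or units, so `D` kills them although it is only assumed `ℤ`-linear; thus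
    -- checking generators over `k` suffices.
    by_cases hc : c = 0
    · simp [hc]
    · rw [LocallyNilpotent.derivation_eq_zero_of_isUnit hD
        ((IsUnit.mk0 c hc).map (algebraMap k B)), map_zero, Derivation.zero_apply]
  | add a b _ _ ha hb => rw [map_add, ha, hb, map_add]
  | mul a b _ _ ha hb => rw [Derivation.leibniz, ha, hb]; simp

/-- A non-rigid finitely generated graded domain has a nonzero homogeneous locally nilpotent
derivation. -/
theorem exists_homogeneous_locallyNilpotent [IsDomain B] [CharZero B] [Algebra.FiniteType k B]
    (h : ¬ IsRigidRing B) : ∃ (D : Derivation ℤ B B) (e : ℤ), IsLocallyNilpotentDerivation D ∧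
      D ≠ 0 ∧ ∀ i, ∀ b ∈ 𝒜 i, D b ∈ 𝒜 (i + e) := by
  simp only [IsRigidRing, not_forall] at h
  obtain ⟨D, hD, hne⟩ := h
  obtain ⟨N, hN⟩ := exists_derivationComponent_eq_zero_of_lt 𝒜 (k := k) hD
  obtain ⟨e, he, hmax⟩ := Int.exists_greatest_of_bdd
    (P := fun j => derivationComponent 𝒜 D j ≠ 0)
    ⟨N, fun j hj => not_lt.1 fun h => hj (hN j h)⟩ (exists_derivationComponent_ne_zero 𝒜 hne)
  refine ⟨derivationComponent 𝒜 D e, e, isLocallyNilpotent_of_homogeneous 𝒜 fun i b hb => ?_, he,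
    fun i b hb => derivationComponent_mem 𝒜 D e hb⟩
  obtain ⟨m, hm⟩ := hD b
  refine ⟨m, ?_⟩
  rw [(iterate_derivationComponent 𝒜 (fun j hj => not_not.1 fun h =>
    (hmax j h).not_gt hj) hb m).2, hm, map_zero]

end HomogeneousComponent

/-! ### Restricting homogeneous derivations to the Veronese subring -/

section Veronese

variable {B : Type*} [CommRing B] (𝒜 : ℤ → AddSubgroup B) [GradedRing 𝒜]

theorem pow_mem_graded {i : ℤ} {b : B} (hb : b ∈ 𝒜 i) (n : ℕ) : b ^ n ∈ 𝒜 (n * i) := by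
  simpa using SetLike.pow_mem_graded n hb

theorem mem_veroneseSubring_of_mem {d : ℕ} {i : ℤ} {b : B} (hb : b ∈ 𝒜 i) (hi : (d : ℤ) ∣ i) :
    b ∈ veroneseSubring 𝒜 d := fun _ hj =>
  GradedRing.proj_of_mem_ne 𝒜 hb fun h => hj (h ▸ hi)

theorem pow_mem_veroneseSubring {d : ℕ} {i : ℤ} {b : B} (hb : b ∈ 𝒜 i) :
    b ^ d ∈ veroneseSubring 𝒜 d :=
  mem_veroneseSubring_of_mem 𝒜 (pow_mem_graded 𝒜 hb d) (dvd_mul_right _ _)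

/-- The degrees of the homogeneous elements of a submonoid, up to multiples of `d`. -/
def degreeSubgroup (M : Submonoid B) (d : ℕ) (hd : 1 ≤ d) : AddSubgroup ℤ where
  carrier := {t | ∃ u ∈ M, ∃ s, u ∈ 𝒜 s ∧ (d : ℤ) ∣ s - t}
  zero_mem' := ⟨1, M.one_mem, 0, SetLike.GradedOne.one_mem, by simp⟩
  add_mem' := by
    rintro t t' ⟨u, hu, s, hs, h⟩ ⟨u', hu', s', hs', h'⟩
    exact ⟨u * u', M.mul_mem hu hu', s + s', SetLike.GradedMul.mul_mem hs hs', by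
      rw [add_sub_add_comm]
      exact dvd_add h h'⟩
  neg_mem' := by
    rintro t ⟨u, hu, s, hs, h⟩
    -- No inverse of `u` is needed: `(d - 1) * s` is congruent to `-s` modulo `d`.
    refine ⟨u ^ (d - 1), M.pow_mem hu _, _, pow_mem_graded 𝒜 hs _, ?_⟩
    have : ((d - 1 : ℕ) : ℤ) * s - -t = d * s - (s - t) := by
      rw [Nat.cast_sub hd]
      push_cast
      ring
    rw [this]
    exact dvd_sub (dvd_mul_right _ _) h

theorem mem_degreeSubgroup_of_mem {M : Submonoid B} {d : ℕ} (hd : 1 ≤ d) {u : B} (hu : u ∈ M)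
    {s : ℤ} (hs : u ∈ 𝒜 s) : s ∈ degreeSubgroup 𝒜 M d hd :=
  ⟨u, hu, s, hs, by simp⟩

theorem AddSubgroup.eq_top_of_gcd_eq_one {ι : Type*} (G : AddSubgroup ℤ) (s : Finset ι)
    (δ : ι → ℤ) (hgcd : s.gcd δ = 1) (h : ∀ j ∈ s, δ j ∈ G) : G = ⊤ := by
  obtain ⟨e, rfl⟩ := Int.subgroup_cyclic G
  have he : e ∣ 1 := hgcd ▸ Finset.dvd_gcd fun j hj => by
    have := h j hj
    rwa [← AddSubgroup.zmultiples_eq_closure, Int.mem_zmultiples_iff] at this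
  rw [eq_top_iff, ← AddSubgroup.zmultiples_eq_closure]
  intro t _
  exact Int.mem_zmultiples_iff.2 (he.trans (one_dvd t))

/-- The nonzero elements of the kernel of a derivation. -/
def kernelSubmonoid [IsDomain B] (D : Derivation ℤ B B) : Submonoid B where
  carrier := {f | f ≠ 0 ∧ D f = 0}
  one_mem' := ⟨one_ne_zero, D.map_one_eq_zero⟩
  mul_mem' := fun ha hb => ⟨mul_ne_zero ha.1 hb.1, by rw [D.leibniz, ha.2, hb.2]; simp⟩

/-- A derivation that vanishes on the Veronese subring vanishes. -/
theorem derivation_eq_zero_of_veronese [IsDomain B] [CharZero B] {d : ℕ} (hd : 1 ≤ d)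
    {D : Derivation ℤ B B} (h : ∀ b ∈ veroneseSubring 𝒜 d, D b = 0) : D = 0 := by
  refine Derivation.ext fun b => ?_
  induction b using homogeneous_induction 𝒜 with
  | zero => simp
  | add a b ha hb => rw [map_add, ha, hb, map_add]
  | hom i b hb =>
    by_cases hb0 : b = 0
    · simp [hb0]
    have h1 := h _ (pow_mem_veroneseSubring 𝒜 (d := d) hb)
    rw [Derivation.leibniz_pow, nsmul_eq_mul, smul_eq_mul] at h1
    have hd0 : (d : B) ≠ 0 := by exact_mod_cast (by omega : d ≠ 0)
    simpa [hd0, hb0] using h1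

/-- The restriction of a derivation to a subring which it preserves. -/
def Derivation.restrictSubring (D : Derivation ℤ B B) (R : Subring B) (h : ∀ r ∈ R, D r ∈ R) :
    Derivation ℤ R R :=
  Derivation.mk' (AddMonoidHom.mk' (fun r : R => (⟨D r, h r r.2⟩ : R))
    fun a b => Subtype.ext (by simp)).toIntLinearMap fun a b => Subtype.ext (by simp)

theorem Derivation.coe_restrictSubring (D : Derivation ℤ B B) (R : Subring B)
    (h : ∀ r ∈ R, D r ∈ R) (r : R) : (D.restrictSubring R h r : B) = D r := rfl

theorem Derivation.coe_iterate_restrictSubring (D : Derivation ℤ B B) (R : Subring B)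
    (h : ∀ r ∈ R, D r ∈ R) (n : ℕ) (r : R) :
    ((D.restrictSubring R h)^[n] r : B) = D^[n] (r : B) := by
  induction n with
  | zero => rfl
  | succ n ih =>
    rw [Function.iterate_succ_apply', Function.iterate_succ_apply', coe_restrictSubring, ih]

theorem derivation_mem_veroneseSubring {d : ℕ} {D : Derivation ℤ B B} {e : ℤ}
    (he : (d : ℤ) ∣ e) (hhom : ∀ i, ∀ b ∈ 𝒜 i, D b ∈ 𝒜 (i + e)) {b : B}
    (hb : b ∈ veroneseSubring 𝒜 d) : D b ∈ veroneseSubring 𝒜 d := by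
  rw [← sum_gradedSupport 𝒜 b, map_sum]
  refine sum_mem fun i hi => ?_
  refine mem_veroneseSubring_of_mem 𝒜 (hhom i _ (GradedRing.proj_mem 𝒜 i b)) (dvd_add ?_ he)
  by_contra hne
  exact (mem_gradedSupport 𝒜).1 hi (hb i hne)

theorem not_isRigid_veronese_of_homogeneous [IsDomain B] [CharZero B] {d : ℕ} (hd : 1 ≤ d)
    {D : Derivation ℤ B B} {e : ℤ} (hD : IsLocallyNilpotentDerivation D) (hne : D ≠ 0)
    (he : (d : ℤ) ∣ e) (hhom : ∀ i, ∀ b ∈ 𝒜 i, D b ∈ 𝒜 (i + e)) :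
    ¬ IsRigidRing (veroneseSubring 𝒜 d) := by
  intro hrigid
  have hpres : ∀ b ∈ veroneseSubring 𝒜 d, D b ∈ veroneseSubring 𝒜 d := fun b hb =>
    derivation_mem_veroneseSubring 𝒜 he hhom hb
  have h0 := hrigid (D.restrictSubring _ hpres) fun r => by
    obtain ⟨m, hm⟩ := hD r
    exact ⟨m, Subtype.ext (by rw [Derivation.coe_iterate_restrictSubring, hm]; rfl)⟩
  refine hne (derivation_eq_zero_of_veronese 𝒜 hd fun b hb => ?_)
  rw [← D.coe_restrictSubring _ hpres ⟨b, hb⟩, h0]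
  rfl

/-- Multiplying `D` by a kernel element keeps it locally nilpotent and shifts its degree, here to a
multiple of `d`. -/
theorem not_isRigid_veronese_of_degreeSubgroup_eq_top [IsDomain B] [CharZero B] {d : ℕ}
    (hd : 1 ≤ d) {D : Derivation ℤ B B} {e : ℤ} (hD : IsLocallyNilpotentDerivation D)
    (hne : D ≠ 0) (hhom : ∀ i, ∀ b ∈ 𝒜 i, D b ∈ 𝒜 (i + e))
    (htop : degreeSubgroup 𝒜 (kernelSubmonoid D) d hd = ⊤) :
    ¬ IsRigidRing (veroneseSubring 𝒜 d) := by
  obtain ⟨f, ⟨hf0, hf⟩, s, hs, hdvd⟩ :=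
    (htop ▸ AddSubgroup.mem_top (-e) : -e ∈ degreeSubgroup 𝒜 (kernelSubmonoid D) d hd)
  refine not_isRigid_veronese_of_homogeneous 𝒜 hd (D := f • D) (e := s + e) (fun b => ?_) ?_
    (by simpa using hdvd) fun i b hb => ?_
  · obtain ⟨m, hm⟩ := hD b
    exact ⟨m, by rw [LocallyNilpotent.iterate_mul_of_derivation_eq_zero hf, hm, mul_zero]⟩
  · intro h
    refine hne (Derivation.ext fun b => ?_)
    have hb := DFunLike.congr_fun h b
    simpa [hf0] using hb
  · have := SetLike.GradedMul.mul_mem hs (hhom i b hb)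
    rwa [add_left_comm] at this

end Veronese

/-! ### Local slices and the degrees of kernel elements -/

section LocalSlice

variable {B : Type*} [CommRing B] (𝒜 : ℤ → AddSubgroup B) [GradedRing 𝒜]

open LocallyNilpotent

theorem exists_homogeneous_localSlice {D : Derivation ℤ B B} {e : ℤ}
    (hD : IsLocallyNilpotentDerivation D) (hne : D ≠ 0)
    (hhom : ∀ i, ∀ b ∈ 𝒜 i, D b ∈ 𝒜 (i + e)) :
    ∃ s p, s ∈ 𝒜 p ∧ HasDegree D s 1 := by
  obtain ⟨i, b, hb, hDb⟩ : ∃ i, ∃ b ∈ 𝒜 i, D b ≠ 0 := by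
    by_contra! h
    refine hne (Derivation.ext fun b => ?_)
    induction b using homogeneous_induction 𝒜 with
    | zero => simp
    | add a b ha hb => rw [map_add, ha, hb, map_add]
    | hom i b hb => exact h i b hb
  have hiter : ∀ n : ℕ, ∃ p, D^[n] b ∈ 𝒜 p := by
    intro n
    induction n with
    | zero => exact ⟨i, hb⟩
    | succ n ih =>
      obtain ⟨p, hp⟩ := ih
      exact ⟨p + e, by rw [Function.iterate_succ_apply']; exact hhom p _ hp⟩
  -- `D^[m] (D b)` is the last nonzero iterate, so `D^[m] b` has degree 1.
  obtain ⟨m, hm⟩ := exists_hasDegree (hD (D b)) hDb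
  obtain ⟨p, hp⟩ := hiter m
  refine ⟨D^[m] b, p, hp, ?_, ?_⟩
  · simpa only [← Function.iterate_add_apply, ← Function.iterate_succ_apply, add_comm] using hm.1
  · simpa only [← Function.iterate_add_apply, ← Function.iterate_succ_apply, add_comm] using hm.2

/-- After multiplication by a power of `D s`, every homogeneous element is congruent modulo the
local slice `s` to a homogeneous element of the kernel. -/
theorem exists_pow_mul_eq_localSlice_mul_add {D : Derivation ℤ B B} {e : ℤ}
    (hhom : ∀ i, ∀ b ∈ 𝒜 i, D b ∈ 𝒜 (i + e)) {s : B} {p : ℤ} (hs : s ∈ 𝒜 p)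
    (hs2 : D (D s) = 0) (m : ℕ) {i : ℤ} {b : B} (hb : b ∈ 𝒜 i) (hm : D^[m + 1] b = 0) :
    ∃ (K N : ℕ) (c f : B), K ≠ 0 ∧ f ∈ 𝒜 (i + N * (p + e)) ∧ D f = 0 ∧
      (K : B) * D s ^ N * b = s * c + f := by
  induction m generalizing i b with
  | zero => exact ⟨1, 0, 0, b, one_ne_zero, by simpa using hb, hm, by simp⟩
  | succ m ih =>
    -- This combination cancels the leading terms: `D^[m + 1] (s * D b)` contributes `(m + 1) * D s
    -- * D^[m + 1] b`. It is congruent to a multiple of `D s * b` modulo `s`.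
    have hb' : ((m + 1 : ℕ) : B) * (D s * b) - s * D b ∈ 𝒜 (i + (p + e)) := by
      refine sub_mem ?_ ?_
      · rw [← nsmul_eq_mul, add_comm i]
        exact nsmul_mem (SetLike.GradedMul.mul_mem (hhom p s hs) hb) _
      · have := SetLike.GradedMul.mul_mem hs (hhom i b hb)
        rwa [add_left_comm] at this
    have hm' : D^[m + 1] (((m + 1 : ℕ) : B) * (D s * b) - s * D b) = 0 := by
      have hDs : D^[0 + 1] (((m + 1 : ℕ) : B) * D s) = 0 := by
        simp [Derivation.leibniz, hs2, -Nat.cast_add]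
      have hconst : ∀ n : ℕ, D^[n] (((m + 1 : ℕ) : B) * D s * b) =
          ((m + 1 : ℕ) : B) * D s * D^[n] b := by
        intro n
        induction n with
        | zero => rfl
        | succ n ihn =>
          rw [Function.iterate_succ_apply', ihn, D.leibniz, Function.iterate_succ_apply']
          simp only [zero_add, Function.iterate_one] at hDs
          rw [hDs]
          simp
      rw [iterate_map_sub, ← mul_assoc, hconst, iterate_localSlice_mul hs2,
        ← Function.iterate_succ_apply, ← Function.iterate_succ_apply, hm]
      push_cast
      ring
    obtain ⟨K, N, c, f, hK, hf, hDf, h⟩ := ih hb' hm'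
    refine ⟨K * (m + 1), N + 1, c + K * D s ^ N * D b, f, by positivity, ?_, hDf, ?_⟩
    · convert hf using 2
      push_cast
      ring
    · push_cast at h ⊢
      linear_combination h

/-- If the kernel is concentrated in degrees divisible by some integer, then two non-associated
homogeneous primes cannot both have degrees not divisible by it. -/
theorem dvd_of_kernel_degrees [IsDomain B] [CharZero B] {D : Derivation ℤ B B} {e e' : ℤ}
    (hD : IsLocallyNilpotentDerivation D) (hne : D ≠ 0)
    (hhom : ∀ i, ∀ b ∈ 𝒜 i, D b ∈ 𝒜 (i + e))
    (hker : ∀ f i, f ∈ 𝒜 i → f ≠ 0 → D f = 0 → e' ∣ i)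
    {x y : B} {i j : ℤ} (hx : x ∈ 𝒜 i) (hy : y ∈ 𝒜 j) (hxp : Prime x) (hyp : Prime y)
    (hxy : ¬ Associated x y) (hi : ¬ e' ∣ i) : e' ∣ j := by
  by_contra hj
  obtain ⟨s, p, hs, hdeg⟩ := exists_homogeneous_localSlice 𝒜 hD hne hhom
  have hs2 : D (D s) = 0 := hdeg.2
  have hDs0 : D s ≠ 0 := hdeg.1
  have hDsdeg : HasDegree D (D s) 0 := hdeg
  have hDs : e' ∣ p + e := hker _ _ (hhom p s hs) hDs0 hs2
  have key : ∀ {z : B} {l : ℤ}, z ∈ 𝒜 l → Prime z → ¬ e' ∣ l → z ∣ s ∧ D z ≠ 0 := by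
    intro z l hz hzp hl
    obtain ⟨m, hm⟩ := exists_hasDegree (hD z) hzp.ne_zero
    obtain ⟨K, N, c, f, hK, hf, hDf, h⟩ :=
      exists_pow_mul_eq_localSlice_mul_add 𝒜 hhom hs hs2 m hz hm.2
    have hf0 : f = 0 := by
      by_contra hf0
      refine hl ?_
      have := hker f _ hf hf0 hDf
      exact (dvd_add_left (hDs.mul_left _)).1 this
    rw [hf0, add_zero] at h
    have hKa : HasDegree D ((K : B) * D s ^ N) 0 := by
      simpa using (hasDegree_natCast D hK).mul (hDsdeg.pow N)
    constructor
    -- If `z` divided `c`, cancelling it would make `s`, of degree 1, divide the degree 0 element `K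
    -- * D s ^ N`.
    · rcases hzp.dvd_or_dvd (Dvd.intro_left _ h : z ∣ s * c) with h1 | ⟨c', rfl⟩
      · exact h1
      · have h2 : (K : B) * D s ^ N = s * c' :=
          mul_right_cancel₀ hzp.ne_zero (by rw [h]; ring)
        have hc' : c' ≠ 0 := by
          rintro rfl
          exact hKa.ne_zero (by rw [h2, mul_zero])
        obtain ⟨n, hn⟩ := exists_hasDegree (hD c') hc'
        have := hKa.unique (h2 ▸ hdeg.mul hn)
        omega
    · intro hDz
      have hdz : HasDegree D z 0 := hasDegree_zero_iff.2 ⟨hzp.ne_zero, hDz⟩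
      have h0 := hKa.mul hdz
      have hc : c ≠ 0 := by
        rintro rfl
        exact h0.ne_zero (by rw [h, mul_zero])
      obtain ⟨n, hn⟩ := exists_hasDegree (hD c) hc
      have := h0.unique (h ▸ hdeg.mul hn)
      omega
  obtain ⟨⟨w, hw⟩, hDx⟩ := key hx hxp hi
  obtain ⟨hys, hDy⟩ := key hy hyp hj
  have hyw : y ∣ w := by
    rcases hyp.dvd_or_dvd (hw ▸ hys) with h | h
    · exact absurd ((hyp.dvd_prime_iff_associated hxp).1 h).symm hxy
    · exact h
  obtain ⟨v, rfl⟩ := hyw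
  have hv : v ≠ 0 := by
    rintro rfl
    exact hdeg.ne_zero (by simp [hw])
  obtain ⟨a, ha⟩ := exists_hasDegree (hD x) hxp.ne_zero
  obtain ⟨b, hb⟩ := exists_hasDegree (hD y) hyp.ne_zero
  obtain ⟨c, hc⟩ := exists_hasDegree (hD v) hv
  have h1 := hdeg.unique (hw ▸ ha.mul (hb.mul hc))
  rcases Nat.eq_zero_or_pos a with rfl | h
  · exact hDx ha.2
  · obtain rfl : b = 0 := by omega
    exact hDy hb.2

theorem not_isRigid_veronese_of_not_isRigid {k : Type*} [Field k] [CharZero k] [IsDomain B]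
    [Algebra k B] [Algebra.FiniteType k B] {ι : Type*} [Fintype ι] [DecidableEq ι] [Nonempty ι]
    {x : ι → B} {δ : ι → ℤ} (hprime : ∀ i, Prime (x i)) (hx : ∀ i, x i ∈ 𝒜 (δ i))
    (hgcd : ∀ i, (Finset.univ.erase i).gcd δ = 1)
    (hassoc : ∀ i j, i ≠ j → ¬ Associated (x i) (x j)) (h : ¬ IsRigidRing B) {d : ℕ}
    (hd : 1 ≤ d) : ¬ IsRigidRing (veroneseSubring 𝒜 d) := by
  have : CharZero B := charZero_of_injective_algebraMap (algebraMap k B).injective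
  obtain ⟨D, e, hD, hne, hhom⟩ := exists_homogeneous_locallyNilpotent 𝒜 (k := k) h
  refine not_isRigid_veronese_of_degreeSubgroup_eq_top 𝒜 hd hD hne hhom ?_
  by_contra htop
  have hout : ∀ i, ∃ j, j ≠ i ∧ δ j ∉ degreeSubgroup 𝒜 (kernelSubmonoid D) d hd := by
    intro i
    by_contra! hin
    exact htop (AddSubgroup.eq_top_of_gcd_eq_one _ _ δ (hgcd i) fun j hj =>
      hin j (Finset.ne_of_mem_erase hj))
  obtain ⟨e', he'⟩ := Int.subgroup_cyclic (degreeSubgroup 𝒜 (kernelSubmonoid D) d hd)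
  have hmem : ∀ t, t ∈ degreeSubgroup 𝒜 (kernelSubmonoid D) d hd ↔ e' ∣ t := fun t => by
    rw [he', ← AddSubgroup.zmultiples_eq_closure, Int.mem_zmultiples_iff]
  -- The gcd condition is used twice: first to find `i`, then with `i` omitted to find `j ≠ i`.
  obtain ⟨i, -, hi⟩ := hout (Classical.arbitrary ι)
  obtain ⟨j, hji, hj⟩ := hout i
  rw [hmem] at hi hj
  exact hj (dvd_of_kernel_degrees 𝒜 hD hne hhom (fun f l hf hf0 hDf =>
    (hmem l).1 (mem_degreeSubgroup_of_mem 𝒜 hd (M := kernelSubmonoid D) ⟨hf0, hDf⟩ hf))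
    (hx i) (hx j) (hprime i) (hprime j) (hassoc i j hji.symm) hi)

end LocalSlice

/-! ### Degree classes modulo `d`, and integrality over the Veronese subring -/

section Coset

variable {B : Type*} [CommRing B] (𝒜 : ℤ → AddSubgroup B) [GradedRing 𝒜]

/-- The elements all of whose homogeneous components have degree congruent to `r` modulo `d`. -/
def veroneseCoset (d : ℕ) (r : ℤ) : AddSubgroup B where
  carrier := {b | ∀ i : ℤ, ¬ (d : ℤ) ∣ i - r → GradedRing.proj 𝒜 i b = 0}
  zero_mem' := fun _ _ => map_zero _
  add_mem' := fun ha hb i hi => by rw [map_add, ha i hi, hb i hi, add_zero]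
  neg_mem' := fun ha i hi => by rw [map_neg, ha i hi, neg_zero]

theorem mem_veroneseCoset_of_mem {d : ℕ} {i r : ℤ} {b : B} (hb : b ∈ 𝒜 i)
    (h : (d : ℤ) ∣ i - r) : b ∈ veroneseCoset 𝒜 d r := fun _ hj =>
  GradedRing.proj_of_mem_ne 𝒜 hb fun hij => hj (hij ▸ h)

theorem dvd_of_mem_gradedSupport {d : ℕ} {r i : ℤ} {b : B} (hb : b ∈ veroneseCoset 𝒜 d r)
    (hi : i ∈ gradedSupport 𝒜 b) : (d : ℤ) ∣ i - r := by
  by_contra hne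
  exact (mem_gradedSupport 𝒜).1 hi (hb i hne)

theorem veroneseCoset_mul_mem {d : ℕ} {r s : ℤ} {a b : B} (ha : a ∈ veroneseCoset 𝒜 d r)
    (hb : b ∈ veroneseCoset 𝒜 d s) : a * b ∈ veroneseCoset 𝒜 d (r + s) := by
  rw [← sum_gradedSupport 𝒜 a, ← sum_gradedSupport 𝒜 b, Finset.sum_mul_sum]
  refine sum_mem fun i hi => sum_mem fun j hj => ?_
  refine mem_veroneseCoset_of_mem 𝒜 (SetLike.GradedMul.mul_mem (GradedRing.proj_mem 𝒜 i a)
    (GradedRing.proj_mem 𝒜 j b)) ?_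
  rw [add_sub_add_comm]
  exact dvd_add (dvd_of_mem_gradedSupport 𝒜 ha hi) (dvd_of_mem_gradedSupport 𝒜 hb hj)

theorem veroneseCoset_pow_mem {d : ℕ} {r : ℤ} {a : B} (ha : a ∈ veroneseCoset 𝒜 d r) (n : ℕ) :
    a ^ n ∈ veroneseCoset 𝒜 d (n * r) := by
  induction n with
  | zero =>
    rw [pow_zero]
    exact mem_veroneseCoset_of_mem 𝒜 SetLike.GradedOne.one_mem (by simp)
  | succ n ih =>
    rw [pow_succ, Nat.cast_succ, add_one_mul]
    exact veroneseCoset_mul_mem 𝒜 ih ha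

theorem pow_mem_veroneseSubring_of_mem_coset {d : ℕ} {r : ℤ} {a : B}
    (ha : a ∈ veroneseCoset 𝒜 d r) : a ^ d ∈ veroneseSubring 𝒜 d := fun i hi =>
  veroneseCoset_pow_mem 𝒜 ha d i fun h => hi (by
    have := dvd_add h (dvd_mul_right (d : ℤ) r)
    rwa [sub_add_cancel] at this)

theorem isIntegral_veroneseSubring {d : ℕ} (hd : 1 ≤ d) :
    Algebra.IsIntegral (veroneseSubring 𝒜 d) B := by
  refine ⟨fun b => ?_⟩
  induction b using homogeneous_induction 𝒜 with
  | zero => exact isIntegral_zero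
  | add a b ha hb => exact ha.add hb
  | hom i b hb =>
    refine IsIntegral.of_pow hd ?_
    exact isIntegral_algebraMap (x := (⟨b ^ d, pow_mem_veroneseSubring 𝒜 hb⟩ :
      veroneseSubring 𝒜 d))

end Coset

/-! ### Cancelling prime denominators -/

section Primes

variable {B L ι : Type*} [CommRing B] [IsDomain B] [Field L] [Algebra B L] [IsFractionRing B L]

theorem Prime.not_dvd_of_mem_closure {x : ι → B} (hprime : ∀ i, Prime (x i))
    (hassoc : ∀ i j, i ≠ j → ¬ Associated (x i) (x j)) {i : ι} {u : B}
    (hu : u ∈ Submonoid.closure (x '' {i}ᶜ)) : ¬ x i ∣ u := by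
  induction hu using Submonoid.closure_induction with
  | mem u hu =>
    obtain ⟨j, hj, rfl⟩ := hu
    exact fun h => hassoc i j (Ne.symm hj) (((hprime i).dvd_prime_iff_associated (hprime j)).1 h)
  | one => exact (hprime i).not_dvd_one
  | mul a b _ _ ha hb => exact fun h => ((hprime i).dvd_or_dvd h).elim ha hb

/-- A fraction belongs to `B` if, for each `i`, it has a denominator which is a product of the
primes `x j` with `j ≠ i`. -/
theorem exists_algebraMap_eq_of_prime_denominators [Nonempty ι] {x : ι → B}
    (hprime : ∀ i, Prime (x i)) (hassoc : ∀ i j, i ≠ j → ¬ Associated (x i) (x j)) {z : L}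
    (h : ∀ i, ∃ u ∈ Submonoid.closure (x '' {i}ᶜ), ∃ w, algebraMap B L u * z = algebraMap B L w) :
    ∃ b, algebraMap B L b = z := by
  -- Induction on a known denominator `m`, removing one prime at a time; `z` is general because a
  -- product `a * b` applies the induction hypothesis to `b * z`.
  have key : ∀ m ∈ Submonoid.closure (Set.range x), ∀ z : L,
      (∀ i, ∃ u ∈ Submonoid.closure (x '' {i}ᶜ), ∃ w,
        algebraMap B L u * z = algebraMap B L w) →
      (∃ w, algebraMap B L m * z = algebraMap B L w) → ∃ b, algebraMap B L b = z := by
    intro m hm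
    induction hm using Submonoid.closure_induction with
    | one =>
      rintro z - ⟨w, hw⟩
      exact ⟨w, by rw [← hw, map_one, one_mul]⟩
    | mul a b _ _ ha hb =>
      rintro z hz ⟨w, hw⟩
      refine hb z hz ?_
      obtain ⟨w', hw'⟩ := ha (algebraMap B L b * z) (fun i => by
        obtain ⟨u, hu, v, hv⟩ := hz i
        exact ⟨u, hu, b * v, by rw [map_mul, ← hv]; ring⟩)
        ⟨w, by rw [← hw, map_mul, mul_assoc]⟩
      exact ⟨w', hw'.symm⟩
    | mem m hm =>
      obtain ⟨i, rfl⟩ := hm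
      rintro z hz ⟨w, hw⟩
      obtain ⟨u, hu, v, hv⟩ := hz i
      -- A denominator `u` not divisible by `x i` forces `x i ∣ w`, so `x i` cancels.
      have huw : x i * v = u * w := by
        apply IsFractionRing.injective B L
        rw [map_mul, map_mul, ← hv, ← hw]
        ring
      rcases (hprime i).dvd_or_dvd (Dvd.intro _ huw) with h1 | ⟨c, rfl⟩
      · exact absurd h1 (Prime.not_dvd_of_mem_closure hprime hassoc hu)
      · refine ⟨c, ?_⟩
        have hx0 : algebraMap B L (x i) ≠ 0 :=
          (map_ne_zero_iff _ (IsFractionRing.injective B L)).2 (hprime i).ne_zero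
        rw [map_mul] at hw
        exact (mul_left_cancel₀ hx0 hw).symm
  obtain ⟨u, hu, hw⟩ := h (Classical.arbitrary ι)
  exact key u (Submonoid.closure_mono (Set.image_subset_range _ _) hu) z h hw

end Primes

/-! ### Extending a locally nilpotent derivation from the Veronese subring to `B` -/

section Extend

variable {B : Type*} [CommRing B] [IsDomain B] [CharZero B] (𝒜 : ℤ → AddSubgroup B)
  [GradedRing 𝒜]

open LocallyNilpotent

/-- An additive map satisfying the Leibniz rule satisfies the power rule. -/
theorem leibniz_pow_of_leibniz {L : Type*} [CommRing L] {E : L →+ L}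
    (hE : ∀ a b, E (a * b) = a * E b + b * E a) (a : L) (n : ℕ) :
    E (a ^ (n + 1)) = (n + 1 : ℕ) * a ^ n * E a := by
  induction n with
  | zero => simp
  | succ n ih =>
    rw [pow_succ, hE, ih]
    push_cast
    ring

/-- A derivation of the Veronese subring extends to `B`. -/
theorem exists_extend_veronese {ι : Type*} [Fintype ι] [DecidableEq ι] [Nonempty ι]
    {x : ι → B} {δ : ι → ℤ} (hprime : ∀ i, Prime (x i)) (hx : ∀ i, x i ∈ 𝒜 (δ i))
    (hgcd : ∀ i, (Finset.univ.erase i).gcd δ = 1)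
    (hassoc : ∀ i j, i ≠ j → ¬ Associated (x i) (x j)) {d : ℕ} (hd : 1 ≤ d)
    (hdu : IsUnit (d : B)) (D : Derivation ℤ (veroneseSubring 𝒜 d) (veroneseSubring 𝒜 d)) :
    ∃ E : Derivation ℤ B B, ∀ r : veroneseSubring 𝒜 d, E r = D r := by
  have : Algebra.IsIntegral (veroneseSubring 𝒜 d) B := isIntegral_veroneseSubring 𝒜 hd
  obtain ⟨E, hE, hED⟩ := Derivation.exists_extend_fractionRing (B := B) D
  set φ := algebraMap B (FractionRing B) with hφ
  have hφi : Function.Injective φ := IsFractionRing.injective B _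
  replace hED : ∀ r : veroneseSubring 𝒜 d, E (φ r) = φ (D r) := hED
  obtain ⟨n, rfl⟩ : ∃ n, d = n + 1 := ⟨d - 1, by omega⟩
  have hmem : ∀ b, ∃ c, φ c = E (φ b) := by
    intro b
    induction b using homogeneous_induction 𝒜 with
    | zero => exact ⟨0, by simp⟩
    | add a b ha hb =>
      obtain ⟨a', ha'⟩ := ha
      obtain ⟨b', hb'⟩ := hb
      exact ⟨a' + b', by simp [ha', hb']⟩
    | hom r b hb =>
      refine exists_algebraMap_eq_of_prime_denominators hprime hassoc fun i => ?_
      have htop : degreeSubgroup 𝒜 (Submonoid.closure (x '' {i}ᶜ)) (n + 1) hd = ⊤ :=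
        AddSubgroup.eq_top_of_gcd_eq_one _ _ δ (hgcd i) fun j hj =>
          mem_degreeSubgroup_of_mem 𝒜 hd (Submonoid.subset_closure
            (Set.mem_image_of_mem x (Finset.ne_of_mem_erase hj : j ∈ ({i}ᶜ : Set ι)))) (hx j)
      obtain ⟨u, hu, s, hs, hdvd⟩ := (htop ▸ AddSubgroup.mem_top (-r) :
        -r ∈ degreeSubgroup 𝒜 (Submonoid.closure (x '' {i}ᶜ)) (n + 1) hd)
      obtain ⟨v, hv⟩ := hdu.exists_right_inv
      let y : veroneseSubring 𝒜 (n + 1) := ⟨u * b, mem_veroneseSubring_of_mem 𝒜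
        (SetLike.GradedMul.mul_mem hs hb) (by simpa using hdvd)⟩
      let t : veroneseSubring 𝒜 (n + 1) := ⟨u ^ (n + 1), pow_mem_veroneseSubring 𝒜 hs⟩
      -- With `d = n + 1` and `v = 1/d`, solve `E (u * b) = u * E b + b * E u` for `E b`,
      -- eliminating `E u` through `E (u ^ d) = d * u ^ n * E u`.
      refine ⟨u ^ (n + 1), Submonoid.pow_mem _ hu _, u ^ n * D y - v * b * D t, ?_⟩
      have h1 : φ (D y) = φ u * E (φ b) + φ b * E (φ u) := by
        rw [← hED y, ← hE, ← map_mul]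
      have h2 : φ (D t) = (n + 1 : ℕ) * φ u ^ n * E (φ u) := by
        rw [← hED t, ← leibniz_pow_of_leibniz hE, ← map_pow]
      have h3 : ((n + 1 : ℕ) : FractionRing B) * φ v = 1 := by
        rw [← map_natCast φ, ← map_mul, hv, map_one]
      rw [← hφ, map_sub, map_mul, map_mul, map_mul, h1, h2, map_pow, map_pow]
      linear_combination φ b * φ u ^ n * E (φ u) * h3
  choose g hg using hmem
  refine ⟨Derivation.mk' (AddMonoidHom.mk' g fun a b => hφi ?_).toIntLinearMap
    fun a b => hφi ?_, fun r => hφi ?_⟩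
  · simp [hg]
  · simp [hg, hE]
  · simp [hg, hED]

/-- A derivation of `B` preserving the Veronese subring preserves degrees modulo `d`. -/
theorem derivation_mem_veroneseCoset {d : ℕ} (hd : 1 ≤ d) {E : Derivation ℤ B B}
    (hE : ∀ r ∈ veroneseSubring 𝒜 d, E r ∈ veroneseSubring 𝒜 d) {r : ℤ} {b : B}
    (hb : b ∈ veroneseCoset 𝒜 d r) : E b ∈ veroneseCoset 𝒜 d r := by
  have hhom : ∀ i, ∀ b ∈ 𝒜 i, E b ∈ veroneseCoset 𝒜 d i := by
    intro i b hb l hl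
    by_cases hb0 : b = 0
    · simp [hb0]
    -- The component of `E (b ^ d) = d * b ^ (d - 1) * E b` in this degree is `d * b ^ (d - 1)`
    -- times the component of `E b` in degree `l`.
    have h1 := hE _ (pow_mem_veroneseSubring 𝒜 (d := d) hb) (((d - 1 : ℕ) : ℤ) * i + l) (by
      intro h
      apply hl
      have h2 := dvd_sub h (dvd_mul_right (d : ℤ) i)
      rw [Nat.cast_sub hd] at h2
      have h3 : ((d : ℤ) - (1 : ℕ)) * i + l - d * i = l - i := by
        push_cast
        ring
      rwa [h3] at h2)
    rw [Derivation.leibniz_pow, map_nsmul, smul_eq_mul, proj_mul_left 𝒜 (pow_mem_graded 𝒜 hb _),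
      nsmul_eq_mul] at h1
    have hd0 : (d : B) ≠ 0 := by exact_mod_cast (by omega : d ≠ 0)
    simpa [hd0, hb0] using h1
  rw [← sum_gradedSupport 𝒜 b, map_sum]
  refine sum_mem fun i hi => ?_
  intro l hl
  refine hhom i _ (GradedRing.proj_mem 𝒜 i b) l fun h => hl ?_
  simpa using dvd_add h (dvd_of_mem_gradedSupport 𝒜 hb hi)

/-- A derivation of `B` preserving the Veronese subring is locally nilpotent if its restriction
is. -/
theorem isLocallyNilpotent_of_veronese {d : ℕ} (hd : 1 ≤ d) {E : Derivation ℤ B B}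
    (hE : ∀ r ∈ veroneseSubring 𝒜 d, E r ∈ veroneseSubring 𝒜 d)
    (hnil : ∀ r ∈ veroneseSubring 𝒜 d, ∃ m : ℕ, E^[m] r = 0) :
    IsLocallyNilpotentDerivation E := by
  -- The induction uses the degree of `b ^ d`, known to exist because `b ^ d` lies in the Veronese
  -- subring. It runs over cosets since `E` preserves degrees only modulo `d`.
  have key : ∀ m : ℕ, ∀ (r : ℤ), ∀ b ∈ veroneseCoset 𝒜 d r, HasDegree E (b ^ d) m →
      ∃ n : ℕ, E^[n] b = 0 := by
    intro m
    induction m using Nat.strong_induction_on with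
    | _ m ih =>
      intro r b hb hm
      by_cases hEb : E b = 0
      · exact ⟨1, hEb⟩
      have hb0 : b ≠ 0 := by
        rintro rfl
        simp at hEb
      have hEbmem := derivation_mem_veroneseCoset 𝒜 hd hE hb
      have hpow : E (b ^ d) = (d : B) * b ^ (d - 1) * E b := by
        rw [Derivation.leibniz_pow, nsmul_eq_mul, smul_eq_mul, mul_assoc]
      have hd0 : (d : B) ≠ 0 := by exact_mod_cast (by omega : d ≠ 0)
      obtain ⟨q, hq⟩ := exists_hasDegree
        (hnil _ (pow_mem_veroneseSubring_of_mem_coset 𝒜 hEbmem)) (pow_ne_zero d hEb)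
      obtain ⟨m, rfl⟩ : ∃ m', m = m' + 1 := by
        refine Nat.exists_eq_succ_of_ne_zero ?_
        rintro rfl
        have h0 : E (b ^ d) = 0 := hm.2
        rw [hpow] at h0
        exact mul_ne_zero (mul_ne_zero hd0 (pow_ne_zero _ hb0)) hEb h0
      have h1 := hm.derivation.pow d
      have h2 : E (b ^ d) ^ d = ((d : ℕ) : B) ^ d * ((b ^ d) ^ (d - 1) * E b ^ d) := by
        rw [hpow, mul_pow, mul_pow, ← pow_mul, ← pow_mul, mul_comm (d - 1) d]
        ring
      rw [h2] at h1
      -- Comparing degrees gives `d * m = (d - 1) * (m + 1) + q`, that is `q = m + 1 - d`, below the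
      -- degree `m + 1` of `b ^ d`.
      have h3 := h1.unique (((hasDegree_natCast E (by omega : d ≠ 0)).pow d).mul
        ((hm.pow (d - 1)).mul hq))
      have hlt : q < m + 1 := by
        obtain ⟨d', rfl⟩ : ∃ d', d = d' + 1 := ⟨d - 1, by omega⟩
        simp only [Nat.add_sub_cancel] at h3
        nlinarith
      obtain ⟨n, hn⟩ := ih q hlt r (E b) hEbmem hq
      exact ⟨n + 1, hn⟩
  refine isLocallyNilpotent_of_homogeneous 𝒜 fun i b hb => ?_
  by_cases hb0 : b = 0
  · exact ⟨0, hb0⟩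
  obtain ⟨m, hm⟩ := exists_hasDegree (hnil _ (pow_mem_veroneseSubring 𝒜 hb)) (pow_ne_zero d hb0)
  exact key m i b (mem_veroneseCoset_of_mem 𝒜 hb (by simp)) hm

theorem not_isRigid_of_not_isRigid_veronese {ι : Type*} [Fintype ι] [DecidableEq ι] [Nonempty ι]
    {x : ι → B} {δ : ι → ℤ} (hprime : ∀ i, Prime (x i)) (hx : ∀ i, x i ∈ 𝒜 (δ i))
    (hgcd : ∀ i, (Finset.univ.erase i).gcd δ = 1)
    (hassoc : ∀ i j, i ≠ j → ¬ Associated (x i) (x j)) {d : ℕ} (hd : 1 ≤ d)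
    (hdu : IsUnit (d : B)) (h : ¬ IsRigidRing (veroneseSubring 𝒜 d)) : ¬ IsRigidRing B := by
  simp only [IsRigidRing, not_forall] at h ⊢
  obtain ⟨D, hD, hne⟩ := h
  obtain ⟨E, hE⟩ := exists_extend_veronese 𝒜 hprime hx hgcd hassoc hd hdu D
  have hpres : ∀ r ∈ veroneseSubring 𝒜 d, E r ∈ veroneseSubring 𝒜 d := fun r hr => by
    rw [hE ⟨r, hr⟩]
    exact (D ⟨r, hr⟩).2
  have hres : E.restrictSubring _ hpres = D :=
    Derivation.ext fun r => Subtype.ext (hE r)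
  refine ⟨E, isLocallyNilpotent_of_veronese 𝒜 hd hpres fun r hr => ?_, ?_⟩
  · obtain ⟨m, hm⟩ := hD ⟨r, hr⟩
    refine ⟨m, ?_⟩
    rw [← hres] at hm
    rw [← E.coe_iterate_restrictSubring _ hpres m ⟨r, hr⟩, hm]
    rfl
  · rintro rfl
    exact hne (Derivation.ext fun r => Subtype.ext (hE r).symm)

end Extend

theorem mainTheorem8 {k B : Type*} [Field k] [CharZero k] [CommRing B] [IsDomain B]
    [IsIntegrallyClosed B] [Algebra k B] [Algebra.FiniteType k B]
    (𝒜 : ℤ → AddSubgroup B) [GradedRing 𝒜]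
    (n : ℕ) (hn : 2 ≤ n) (x : Fin n → B) (δ : Fin n → ℤ)
    (hgen : Algebra.adjoin (𝒜 0) (Set.range x) = ⊤)
    (hprime : ∀ i, Prime (x i))
    (hhom : ∀ i, x i ∈ 𝒜 (δ i))
    (hδ : ∀ i, δ i ≠ 0)
    (hgcd : ∀ i, (Finset.univ.erase i).gcd δ = 1)
    (hassoc : ∀ i j, i ≠ j → ¬ Associated (x i) (x j)) :
    [¬ IsRigidRing B,
      ∀ d : ℕ, 1 ≤ d → ¬ IsRigidRing (veroneseSubring 𝒜 d),
      ∃ d : ℕ, 1 ≤ d ∧ ¬ IsRigidRing (veroneseSubring 𝒜 d)].TFAE := by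
  have : Nonempty (Fin n) := ⟨⟨0, by omega⟩⟩
  have : CharZero B := charZero_of_injective_algebraMap (algebraMap k B).injective
  tfae_have 1 → 2 := fun h d hd =>
    not_isRigid_veronese_of_not_isRigid 𝒜 (k := k) hprime hhom hgcd hassoc h hd
  tfae_have 2 → 3 := fun h => ⟨1, le_rfl, h 1 le_rfl⟩
  tfae_have 3 → 1 := by
    rintro ⟨d, hd, h⟩
    have hdu : IsUnit (d : B) := by
      rw [← map_natCast (algebraMap k B)]
      exact (IsUnit.mk0 (d : k) (by exact_mod_cast (by omega : d ≠ 0))).map _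
    exact not_isRigid_of_not_isRigid_veronese 𝒜 hprime hhom hgcd hassoc hd hdu h
  tfae_finish
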